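/- Let $G$ be a Lie group modelled on a Hausdorff locally convex real topological vector space $E$; that is, $G$ is a group and a Hausdorff smooth manifold modelled on $E$, with smooth multiplication $m\colon G\times G\to G$ and smooth inversion, where smoothness is in the sense of Bastiani calculus (all iterated directional derivatives exist and are jointly continuous). Suppose that $G$ is Milnor regular: every smooth curve $u\colon[0,1]\to\mathfrak g=T_1G$ is the left logarithmic derivative of a (necessarily unique) smooth curve $\gamma_u\colon[0,1]\to G$ with $\gamma_u(0)=1$, i.e. $\gamma_u'(t)=T_1L_{\gamma_u(t)}(u(t))$ for all $t$, where $L_g$ denotes left translation by $g$, and the map $C^\infty([0,1],\mathfrak g)\to G$, $u\mapsto\gamma_u(1)$, is smooth, where $C^\infty([0,1],\mathfrak g)$ carries the topology of uniform convergence of all derivatives. Call a smooth real-valued differential $2$-form $\eta$ on $G$ primitive if $m^*\eta=\mathrm{pr}_1^*\eta+\mathrm{pr}_2^*\eta$ on $G\times G$, where $\mathrm{pr}_1,\mathrm{pr}_2\colon G\times G\to G$ are the projections. Then every primitive $2$-form on $G$ is zero. -/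

import Mathlib

open Set Filter Topology

noncomputable section

namespace LocConvex

/-! ### Smooth maps between locally convex spaces (Bastiani calculus) -/

section Calculus

variable {E : Type*} [AddCommGroup E] [Module ℝ E] [TopologicalSpace E]
variable {F : Type*} [AddCommGroup F] [Module ℝ F] [TopologicalSpace F]

/-- `w` is the directional derivative of `f` at `x` in the direction `v`, that is
`w = lim_{t → 0} (f (x + t v) - f x) / t`. -/
def HasDirDeriv (f : E → F) (x v : E) (w : F) : Prop :=
  Tendsto (fun t : ℝ => t⁻¹ • (f (x + t • v) - f x)) (𝓝[≠] (0 : ℝ)) (𝓝 w)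

/-- The directional derivative `df(x; v)` (meaningful when it exists and `F` is Hausdorff). -/
def dirDeriv (f : E → F) (x v : E) : F :=
  limUnder (𝓝[≠] (0 : ℝ)) (fun t : ℝ => t⁻¹ • (f (x + t • v) - f x))

/-- The iterated directional derivative `d⁽ᵏ⁾f(x; v₁, …, vₖ) = (D_{vₖ} ⋯ D_{v₁} f)(x)`. -/
def iterDirDeriv (f : E → F) : (k : ℕ) → (Fin k → E) → E → F
  | 0, _ => f
  | k + 1, v => fun x => dirDeriv (iterDirDeriv f k (Fin.init v)) x (v (Fin.last k))

/-- `f` is smooth (`C^∞` in the sense of Bastiani) on the open set `U`: all iterated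
directional derivatives exist on `U`, and each `d⁽ᵏ⁾f : U × Eᵏ → F` is continuous. -/
def SmoothOn (f : E → F) (U : Set E) : Prop :=
  ∀ k : ℕ,
    (∀ x ∈ U, ∀ (v : Fin k → E) (w : E), ∃ z : F, HasDirDeriv (iterDirDeriv f k v) x w z) ∧
    ContinuousOn (fun p : E × (Fin k → E) => iterDirDeriv f k p.2 p.1) (U ×ˢ univ)

/-- `w` is the derivative at `t` of the curve `c`, within the set `S` of parameters. -/
def HasVelocityWithin (c : ℝ → E) (w : E) (S : Set ℝ) (t : ℝ) : Prop :=
  Tendsto (fun s : ℝ => (s - t)⁻¹ • (c s - c t)) (𝓝[S \ {t}] t) (𝓝 w)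

/-- The curve `c` is smooth on `S` (a relatively open subset of a nondegenerate interval):
it has derivatives of all orders within `S`. -/
def SmoothCurveOn (c : ℝ → E) (S : Set ℝ) : Prop :=
  ∃ d : ℕ → ℝ → E, EqOn (d 0) c S ∧
    ∀ k : ℕ, ∀ t ∈ S, HasVelocityWithin (d k) (d (k + 1) t) S t

end Calculus

/-! ### Manifolds modelled on a locally convex space -/

section Manifolds

variable (E : Type*) [AddCommGroup E] [Module ℝ E] [TopologicalSpace E]
variable (F : Type*) [AddCommGroup F] [Module ℝ F] [TopologicalSpace F]

/-- `M` is a smooth (Hausdorff) manifold modelled on the locally convex space `E`: any two charts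
of its atlas are smoothly compatible. -/
class IsLCManifold (M : Type*) [TopologicalSpace M] [ChartedSpace E M] : Prop where
  t2 : T2Space M
  compatible : ∀ e ∈ atlas E M, ∀ e' ∈ atlas E M,
    SmoothOn (fun y : E => e' (e.symm y)) (e.symm.trans e').source

/-- The product manifold, modelled on `E × F`, with the products of charts as its atlas. -/
instance prodCharted (M : Type*) [TopologicalSpace M] [ChartedSpace E M]
    (N : Type*) [TopologicalSpace N] [ChartedSpace F N] : ChartedSpace (E × F) (M × N) :=
  prodChartedSpace E M F N

variable {M : Type*} [TopologicalSpace M] [ChartedSpace E M]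
variable {N : Type*} [TopologicalSpace N] [ChartedSpace F N]

/-- `f : M → N` is a smooth map of manifolds: it is continuous, and smooth in all charts. -/
def SmoothMap (f : M → N) : Prop :=
  Continuous f ∧ ∀ e ∈ atlas E M, ∀ e' ∈ atlas F N,
    SmoothOn (fun y : E => e' (f (e.symm y))) (e.target ∩ (fun y => f (e.symm y)) ⁻¹' e'.source)

/-- The tangent space of `M` at `x`: a tangent vector is represented by its component
in the preferred chart `chartAt E x` (the convention of Mathlib's `TangentSpace`). -/
abbrev TSpace (_x : M) : Type _ := E

/-- The tangent map `T_x f : T_x M → T_{f x} N`. -/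
def tangentMap (f : M → N) (x : M) (v : TSpace E x) : TSpace F (f x) :=
  dirDeriv (fun y : E => chartAt F (f x) (f ((chartAt E x).symm y))) (chartAt E x x) v

/-- A family of alternating `k`-linear forms on the tangent spaces of `M`. -/
abbrev FormField (M : Type*) [TopologicalSpace M] [ChartedSpace E M] (k : ℕ) : Type _ :=
  (x : M) → (TSpace E x) [⋀^Fin k]→ₗ[ℝ] ℝ

variable {E}

/-- The values of the pullback `f^* η`, namely
`(f^* η)_x (v₁, …, vₖ) = η_{f x} (T_x f v₁, …, T_x f vₖ)`. -/
def pullback {k : ℕ} (f : M → N) (η : FormField F N k) (x : M) (v : Fin k → TSpace E x) : ℝ :=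
  η (f x) (fun i => tangentMap E F f x (v i))

/-- `η` is a (smooth, real-valued) differential `k`-form on `M`: in every chart `e`, the local
representative `e.target × Eᵏ → ℝ` is smooth. In particular every `η x` is continuous. -/
def IsDifferentialForm {k : ℕ} (η : FormField E M k) : Prop :=
  ∀ e ∈ atlas E M,
    SmoothOn (fun p : E × (Fin k → E) => pullback (M := E) E (fun y => e.symm y) η p.1 p.2)
      (e.target ×ˢ univ)

end Manifolds

/-! ### Lie groups modelled on locally convex spaces -/

section Groups

variable (E : Type*) [AddCommGroup E] [Module ℝ E] [TopologicalSpace E]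

/-- `G` is a Lie group modelled on the locally convex space `E`. -/
class IsLCLieGroup (G : Type*) [TopologicalSpace G] [ChartedSpace E G] [Group G] : Prop
    extends IsLCManifold E G where
  smooth_mul : SmoothMap (E × E) E (fun p : G × G => p.1 * p.2)
  smooth_inv : SmoothMap E E (fun g : G => g⁻¹)

variable {E}

/-- `η` is primitive: `m^* η = pr₁^* η + pr₂^* η` on `G × G`. -/
def IsPrimitive {G : Type*} [TopologicalSpace G] [ChartedSpace E G] [Group G] {k : ℕ}
    (η : FormField E G k) : Prop :=
  ∀ (x : G × G) (v : Fin k → TSpace (E × E) x),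
    pullback E (fun p : G × G => p.1 * p.2) η x v =
      pullback E (Prod.fst : G × G → G) η x v + pullback E (Prod.snd : G × G → G) η x v

variable [IsTopologicalAddGroup E] [ContinuousSMul ℝ E]

theorem HasVelocityWithin.add {c c' : ℝ → E} {w w' : E} {S : Set ℝ} {t : ℝ}
    (h : HasVelocityWithin c w S t) (h' : HasVelocityWithin c' w' S t) :
    HasVelocityWithin (c + c') (w + w') S t := by
  refine (Tendsto.add h h').congr fun s => ?_
  simp only [Pi.add_apply, ← smul_add]
  congr 1
  abel

theorem HasVelocityWithin.const_smul (a : ℝ) {c : ℝ → E} {w : E} {S : Set ℝ} {t : ℝ}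
    (h : HasVelocityWithin c w S t) : HasVelocityWithin (a • c) (a • w) S t := by
  refine (Tendsto.const_smul h a).congr fun s => ?_
  simp only [Pi.smul_apply, ← smul_sub]
  rw [smul_comm]

variable (E)

/-- The space `C^∞([0,1], E)` of smooth curves. A smooth curve is given by the sequence
`(u, u', u'', …)` of its derivatives, so that the subspace topology inherited from
`∏ₖ C([0,1], E)` is the topology of uniform convergence of all derivatives
(the compact-open `C^∞`-topology). -/
def SmoothCurves : Submodule ℝ (ℕ → C(unitInterval, E)) where
  carrier := {u | ∀ (k : ℕ) (t : unitInterval),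
    HasVelocityWithin (IccExtend zero_le_one (u k)) (u (k + 1) t) (Icc 0 1) t}
  zero_mem' := by
    intro k t
    refine tendsto_const_nhds.congr fun s => ?_
    simp [IccExtend]
  add_mem' := fun hu hv k t => (hu k t).add (hv k t)
  smul_mem' := fun a _ hu k t => (hu k t).const_smul a

variable {E} {G : Type*} [TopologicalSpace G] [ChartedSpace E G] [Group G]

/-- `γ : [0,1] → G` (only its values on `[0,1]` matter) is a smooth curve starting at the identity
with left logarithmic derivative `u`, that is `γ 0 = 1` and
`γ'(t) = T_1(L_{γ t}) (u t)` for all `t ∈ [0,1]`. Here `u` is a smooth curve in the Lie algebra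
`T_1 G`, and `γ'(t)` is read in the preferred chart at `γ t`. -/
structure IsEvolution (γ : ℝ → G) (u : SmoothCurves (TSpace E (1 : G))) : Prop where
  init : γ 0 = 1
  continuousOn : ContinuousOn γ (Icc 0 1)
  smooth : ∀ e ∈ atlas E G, SmoothCurveOn (fun t => e (γ t)) (Icc 0 1 ∩ γ ⁻¹' e.source)
  logDeriv : ∀ t : unitInterval,
    HasVelocityWithin (fun s : ℝ => chartAt E (γ t) (γ s))
      (tangentMap E E (fun g : G => γ t * g) 1 (u.1 0 t)) (Icc 0 1) t

variable (E G)

/-- The Lie group `G` is Milnor regular: every smooth curve `u : [0,1] → T_1 G` in its Lie algebra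
is the left logarithmic derivative of a (necessarily unique) smooth curve `Evol u : [0,1] → G`
starting at the identity, and `C^∞([0,1], T_1 G) → G`, `u ↦ Evol u 1`, is smooth. -/
def IsMilnorRegular : Prop :=
  ∃ Evol : SmoothCurves (TSpace E (1 : G)) → ℝ → G,
    (∀ u, IsEvolution (Evol u) u) ∧
    SmoothMap (SmoothCurves (TSpace E (1 : G))) E (fun u => Evol u 1)

end Groups

end LocConvex

end

/-! The identity for `m^* η` is evaluated at two kinds of points, and no integration or evolution
map enters. At `(1, 1)`, `T m` is the identity on each factor, so `η_1(v, w)` is the value of `m^*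
η` on `(v, 0), (0, w)`. Each projection kills one of these vectors, hence `η_1 = 0`
(`IsPrimitive.apply_one_eq_zero`). At `(g⁻¹, g)`, on vectors `(0, u_i)`, the `pr₁` term vanishes and
`η_g` equals a value of `η_1`, hence is zero (`IsPrimitive.eq_zero_of_apply_one_eq_zero`). -/

namespace LocConvex

section DirectionalDerivative

variable {E : Type*} [AddCommGroup E] [Module ℝ E]
variable {F : Type*} [AddCommGroup F] [Module ℝ F] [TopologicalSpace F] [T2Space F]

/-- The derivative of a map that is affine near `x` along the line `t ↦ x + t v`. -/
theorem dirDeriv_eq_of_eventually_affine {f : E → F} {x v : E} {w : F}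
    (h : ∀ᶠ t : ℝ in 𝓝 0, f (x + t • v) = f x + t • w) : dirDeriv f x v = w := by
  -- The difference quotient is constantly `w` for small `t ≠ 0`; `F` being Hausdorff identifies
  -- `limUnder` with this limit.
  refine Tendsto.limUnder_eq (tendsto_const_nhds.congr' ?_)
  filter_upwards [h.filter_mono nhdsWithin_le_nhds, self_mem_nhdsWithin] with t ht ht0
  rw [ht, add_sub_cancel_left, inv_smul_smul₀ ht0]

end DirectionalDerivative

variable {E : Type*} [AddCommGroup E] [Module ℝ E] [TopologicalSpace E]
  [IsTopologicalAddGroup E] [ContinuousSMul ℝ E]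

/-- Short straight segments stay in the domain of a chart. -/
theorem eventually_chartAt_add_smul_mem_target {M : Type*} [TopologicalSpace M] [ChartedSpace E M]
    (x : M) (v : E) :
    ∀ᶠ t : ℝ in 𝓝 0, chartAt E x x + t • v ∈ (chartAt E x).target := by
  have hc : Tendsto (fun t : ℝ => chartAt E x x + t • v) (𝓝 0) (𝓝 (chartAt E x x)) := by
    have : Continuous fun t : ℝ => chartAt E x x + t • v := by fun_prop
    simpa using this.tendsto 0
  exact hc ((chartAt E x).open_target.mem_nhds (mem_chart_target E x))

variable [T2Space E]

section Projections

variable {M N : Type*} [TopologicalSpace M] [ChartedSpace E M]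
  [TopologicalSpace N] [ChartedSpace E N]

/-- The preferred chart of `M × N` is a product chart, so only the first coordinate has to stay in a
chart target. -/
theorem tangentMap_fst (x : M × N) (v : E × E) :
    tangentMap (E × E) E (Prod.fst : M × N → M) x v = v.1 := by
  refine dirDeriv_eq_of_eventually_affine ?_
  filter_upwards [eventually_chartAt_add_smul_mem_target (E := E) x.1 v.1] with t ht
  change chartAt E x.1 ((chartAt E x.1).symm (chartAt E x.1 x.1 + t • v.1)) =
    chartAt E x.1 ((chartAt E x.1).symm (chartAt E x.1 x.1)) + t • v.1
  rw [(chartAt E x.1).right_inv ht, (chartAt E x.1).right_inv (mem_chart_target E x.1)]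

theorem tangentMap_snd (x : M × N) (v : E × E) :
    tangentMap (E × E) E (Prod.snd : M × N → N) x v = v.2 := by
  refine dirDeriv_eq_of_eventually_affine ?_
  filter_upwards [eventually_chartAt_add_smul_mem_target (E := E) x.2 v.2] with t ht
  change chartAt E x.2 ((chartAt E x.2).symm (chartAt E x.2 x.2 + t • v.2)) =
    chartAt E x.2 ((chartAt E x.2).symm (chartAt E x.2 x.2)) + t • v.2
  rw [(chartAt E x.2).right_inv ht, (chartAt E x.2).right_inv (mem_chart_target E x.2)]

theorem pullback_fst {k : ℕ} (η : FormField E M k) (x : M × N) (v : Fin k → E × E) :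
    pullback E (Prod.fst : M × N → M) η x v = η x.1 fun i => (v i).1 := by
  simp only [pullback, tangentMap_fst]

theorem pullback_snd {k : ℕ} (η : FormField E N k) (x : M × N) (v : Fin k → E × E) :
    pullback E (Prod.snd : M × N → N) η x v = η x.2 fun i => (v i).2 := by
  simp only [pullback, tangentMap_snd]

end Projections

variable {G : Type*} [TopologicalSpace G] [ChartedSpace E G] [Group G]

/-- Along `(v, 0)` the second factor stays at `1`, so in the chart at `1` the product is the
straight line itself. -/
theorem tangentMap_mul_one_left (v : E) :
    tangentMap (E × E) E (fun p : G × G => p.1 * p.2) (1, 1) (v, 0) = v := by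
  refine dirDeriv_eq_of_eventually_affine ?_
  filter_upwards [eventually_chartAt_add_smul_mem_target (E := E) (1 : G) v] with t ht
  change chartAt E ((1 : G) * 1) ((chartAt E (1 : G)).symm (chartAt E (1 : G) 1 + t • v) *
      (chartAt E (1 : G)).symm (chartAt E (1 : G) 1 + t • (0 : E))) =
    chartAt E ((1 : G) * 1) ((chartAt E (1 : G)).symm (chartAt E (1 : G) 1) *
      (chartAt E (1 : G)).symm (chartAt E (1 : G) 1)) + t • v
  rw [smul_zero, add_zero, (chartAt E (1 : G)).left_inv (mem_chart_source E 1), mul_one, mul_one,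
    (chartAt E (1 : G)).right_inv ht]

theorem tangentMap_mul_one_right (v : E) :
    tangentMap (E × E) E (fun p : G × G => p.1 * p.2) (1, 1) (0, v) = v := by
  refine dirDeriv_eq_of_eventually_affine ?_
  filter_upwards [eventually_chartAt_add_smul_mem_target (E := E) (1 : G) v] with t ht
  change chartAt E ((1 : G) * 1) ((chartAt E (1 : G)).symm (chartAt E (1 : G) 1 + t • (0 : E)) *
      (chartAt E (1 : G)).symm (chartAt E (1 : G) 1 + t • v)) =
    chartAt E ((1 : G) * 1) ((chartAt E (1 : G)).symm (chartAt E (1 : G) 1) *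
      (chartAt E (1 : G)).symm (chartAt E (1 : G) 1)) + t • v
  rw [smul_zero, add_zero, (chartAt E (1 : G)).left_inv (mem_chart_source E 1), one_mul, one_mul,
    (chartAt E (1 : G)).right_inv ht]

/-- A primitive 2-form vanishes at the identity: there `T m (v, 0) = v` and `T m (0, w) = w`, while
`pr₁^* η` and `pr₂^* η` vanish on the pair `(v, 0), (0, w)`. -/
theorem IsPrimitive.apply_one_eq_zero {η : FormField E G 2} (h : IsPrimitive η) :
    η 1 = 0 := by
  ext u
  have key := h (1, 1) ![(u 0, 0), (0, u 1)]
  rw [pullback_fst, pullback_snd] at key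
  -- The base point stays `1 * 1`, as `pullback` produces it; every `TSpace` is `E`, so `one_mul`
  -- can rewrite it afterwards.
  have hm : pullback E (fun p : G × G => p.1 * p.2) η (1, 1) ![(u 0, 0), (0, u 1)] =
      η (1 * 1) u := by
    refine congrArg (η (1 * 1)) (funext fun i => ?_)
    fin_cases i
    · exact tangentMap_mul_one_left (u 0)
    · exact tangentMap_mul_one_right (u 1)
  rw [(η _).map_coord_zero (1 : Fin 2) rfl, (η _).map_coord_zero (0 : Fin 2) rfl,
    add_zero, hm, one_mul] at key
  exact key

/-- A primitive form of positive degree is determined by its value at the identity, by left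
invariance: `η_g (v₁, …) = (L_{g⁻¹}^* η)_g (v₁, …)`. -/
theorem IsPrimitive.eq_zero_of_apply_one_eq_zero {k : ℕ} {η : FormField E G (k + 1)}
    (h : IsPrimitive η) (h1 : η 1 = 0) : η = 0 := by
  ext g u
  have key := h (g⁻¹, g) fun i => (0, u i)
  rw [pullback_fst, pullback_snd] at key
  -- The form vanishes at the product point, so `T m` need not be computed there.
  have hm : η (g⁻¹ * g) = 0 := by rw [inv_mul_cancel]; exact h1
  -- Positive degree supplies a slot holding a zero vector. In degree `0` the statement fails for
  -- nontrivial smooth homomorphisms `G → ℝ`.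
  rw [(η _).map_coord_zero (0 : Fin (k + 1)) rfl, zero_add] at key
  refine key.symm.trans ?_
  change η (g⁻¹ * g) _ = 0
  rw [hm]
  rfl

end LocConvex

/-- There are no nonzero primitive 2-forms on a Milnor regular Lie group. -/
theorem mainTheorem3 {E : Type*} [AddCommGroup E] [Module ℝ E] [TopologicalSpace E]
    [IsTopologicalAddGroup E] [ContinuousSMul ℝ E] [LocallyConvexSpace ℝ E] [T2Space E]
    {G : Type*} [TopologicalSpace G] [ChartedSpace E G] [Group G]
    [LocConvex.IsLCLieGroup E G] (hG : LocConvex.IsMilnorRegular E G)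
    (η : LocConvex.FormField E G 2) (hη : LocConvex.IsDifferentialForm η)
    (hprim : LocConvex.IsPrimitive η) : η = 0 :=
  hprim.eq_zero_of_apply_one_eq_zero hprim.apply_one_eq_zero
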